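/- Let $d,N,m\ge 1$ be integers and let $\mathcal H=\ell^2(\mathbb Z^d)\otimes\mathbb C^N$, with translations $(U_vf)(x)=f(x+v)$, $v\in\mathbb Z^d$. Let $\Delta$ be the discrete Laplacian $(\Delta f)(x)=\sum_{|y-x|_1=1}f(y)$ and let $A$ be a nonsingular Hermitian $N\times N$ matrix (the scalar model is $N=1$, $A=1$). Let $\mathcal J\subset\mathbb Z^d$ be a subgroup, let $P_0$ be an orthogonal projection on $\mathcal H$ of rank $m$, put $P_i=U_iP_0U_i^{-1}$ for $i\in\mathcal J$, and assume $\sum_{i\in\mathcal J}P_i=I$ (strongly). Let $(\omega_i)_{i\in\mathcal J}$ be independent, identically distributed real random variables on a probability space $(\Omega,\mathbb P)$ whose common law has a bounded, compactly supported density. Let $$H^\omega=\Delta\otimes A+\sum_{i\in\mathcal J}\omega_iP_i .$$ An energy $E$ belongs to the localization regime if there is an open interval $I\ni E$ such that at least one of the following holds. (a) (Dynamical localization) For every $p\in\mathbb N$ there is a constant $C_p$ with $$\mathbb E\Big[\sup_{f,a}\big\|\big(f(H^\omega)(\delta_y\otimes e_a)\big)(x)\big\|\Big]\le \frac{C_p}{(1+\|x-y\|)^{p}}\qquad\text{for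 all }x,y\in\mathbb Z^d,$$ the supremum being over the continuous $f:\mathbb R\to\mathbb R$ with $|f|\le 1$ that vanish outside $I$ and over the standard basis vectors $e_a$ of $\mathbb C^N$. (b) (Spectral localization) Almost surely, $H^\omega$ has pure point spectrum in $I$, and every eigenfunction $\psi$ of $H^\omega$ with eigenvalue in $I$ satisfies $\sup_x(1+\|x\|)^p\|\psi(x)\|<\infty$ for every $p\in\mathbb N$. Then, with probability one, every eigenvalue of $H^\omega$ that lies in the localization regime has multiplicity at most $m$. -/

import Mathlib

open MeasureTheory ProbabilityTheory Set Module
open scoped ENNReal NNReal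

namespace GenAnderson

/-- The Hilbert space `ℓ²(ℤᵈ) ⊗ ℂᴺ`, realised as `ℓ²(ℤᵈ; ℂᴺ)`. The scalar case is `N = 1`. -/
abbrev Hil (d N : ℕ) : Type :=
  lp (fun _ : Fin d → ℤ => EuclideanSpace ℂ (Fin N)) 2

theorem memℓp_shift {d N : ℕ} (v : Fin d → ℤ) (f : Hil d N) :
    Memℓp (E := fun _ : Fin d → ℤ => EuclideanSpace ℂ (Fin N)) (fun x => f (x + v)) 2 := by
  refine memℓp_gen ?_
  have h := (lp.memℓp f).summable (by norm_num)
  exact (Equiv.addRight v).summable_iff.mpr h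

/-- The unitary translation `(U_v f)(x) = f (x + v)`, as a bounded operator. -/
noncomputable def shift (d N : ℕ) (v : Fin d → ℤ) : Hil d N →L[ℂ] Hil d N :=
  LinearMap.mkContinuous
    { toFun := fun f => ⟨fun x => f (x + v), memℓp_shift v f⟩
      map_add' := fun _ _ => rfl
      map_smul' := fun _ _ => rfl }
    1
    (fun f => by
      refine le_of_eq ?_
      rw [one_mul, lp.norm_eq_tsum_rpow (by norm_num), lp.norm_eq_tsum_rpow (by norm_num)]
      congr 1
      exact (Equiv.addRight v).tsum_eq (fun x => ‖f x‖ ^ (2 : ℝ≥0∞).toReal))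

/-- The discrete Laplacian `(Δ f)(x) = ∑_{|y - x|₁ = 1} f y`, acting on the `ℤᵈ` variable
(that is, `Δ ⊗ I`). -/
noncomputable def laplacian (d N : ℕ) : Hil d N →L[ℂ] Hil d N :=
  ∑ j : Fin d, (shift d N (Pi.single j 1) + shift d N (-Pi.single j 1))

/-- The operator `I ⊗ A`: the matrix `A` acts on the fibre `ℂᴺ` at every site. -/
noncomputable def fibre (d : ℕ) {N : ℕ} (A : Matrix (Fin N) (Fin N) ℂ) :
    Hil d N →L[ℂ] Hil d N :=
  lp.mapCLM 2 (fun _ => Matrix.toEuclideanCLM (𝕜 := ℂ) A)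
    (norm_nonneg (Matrix.toEuclideanCLM (𝕜 := ℂ) A)) (fun _ => le_rfl)

/-- The hopping operator `Δ ⊗ A`. -/
noncomputable def kinetic (d : ℕ) {N : ℕ} (A : Matrix (Fin N) (Fin N) ℂ) :
    Hil d N →L[ℂ] Hil d N :=
  (laplacian d N).comp (fibre d A)

/-- The translate `U_i P₀ U_i⁻¹` (with `U_i⁻¹ = U_{-i}`). -/
noncomputable def translate {d N : ℕ} (P₀ : Hil d N →L[ℂ] Hil d N) (i : Fin d → ℤ) :
    Hil d N →L[ℂ] Hil d N :=
  (shift d N i).comp (P₀.comp (shift d N (-i)))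

open scoped Classical in
/-- The operator `f ↦ ∑ i, v i • P i f`, the series converging unconditionally in norm for each
`f`. (It is set to `0` if there is no such bounded operator; by `potential_hasSum` this does not
happen for bounded `v` and a resolution of the identity `P`.) -/
noncomputable def potential {E ι : Type*} [NormedAddCommGroup E] [InnerProductSpace ℂ E]
    (P : ι → E →L[ℂ] E) (v : ι → ℝ) : E →L[ℂ] E :=
  if h : ∃ T : E →L[ℂ] E, ∀ f, HasSum (fun i => (v i : ℂ) • P i f) (T f) then h.choose else 0

theorem potential_hasSum {E ι : Type*} [NormedAddCommGroup E] [InnerProductSpace ℂ E]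
    [CompleteSpace E] (P : ι → E →L[ℂ] E) (hP : ∀ i, IsStarProjection (P i))
    (hsum : ∀ f, HasSum (fun i => P i f) f) (v : ι → ℝ) {K : ℝ} (hv : ∀ i, |v i| ≤ K) (f : E) :
    HasSum (fun i => (v i : ℂ) • P i f) (potential P v f) := by
  classical
  have idem : ∀ i g, P i (P i g) = P i g := fun i g => by
    have := (hP i).isIdempotentElem
    exact congrArg (fun T : E →L[ℂ] E => T g) this
  have sa : ∀ i g h, inner ℂ (P i g) h = inner ℂ g (P i h) := fun i g h => by
    have h1 : ContinuousLinearMap.adjoint (P i) = P i := (hP i).isSelfAdjoint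
    rw [← ContinuousLinearMap.adjoint_inner_right, h1]
  have nsq : ∀ i g, inner ℂ g (P i g) = ((‖P i g‖ ^ 2 : ℝ) : ℂ) := fun i g => by
    rw [← idem i g, ← sa, inner_self_eq_norm_sq_to_K, idem]; norm_cast
  have pars : ∀ g, HasSum (fun i => ‖P i g‖ ^ 2) (‖g‖ ^ 2) := fun g => by
    have h1 := (hsum g).mapL (innerSL (𝕜 := ℂ) g)
    simp only [innerSL_apply_apply, nsq, inner_self_eq_norm_sq_to_K] at h1
    rw [← Complex.hasSum_ofReal]
    simpa using h1
  have orth : ∀ i j, i ≠ j → ∀ g, P i (P j g) = 0 := fun i j hij g => by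
    have h1 := sum_le_hasSum {i, j} (fun _ _ => by positivity) (pars (P j g))
    rw [Finset.sum_pair hij, idem] at h1
    have : ‖P i (P j g)‖ ^ 2 ≤ 0 := by linarith
    simpa using le_antisymm this (by positivity)
  have pyth : ∀ (s : Finset ι) (c : ι → ℂ) (g : E),
      ‖∑ i ∈ s, c i • P i g‖ ^ 2 = ∑ i ∈ s, ‖c i‖ ^ 2 * ‖P i g‖ ^ 2 := fun s c g => by
    induction s using Finset.induction_on with
    | empty => simp
    | insert a s ha ih =>
      have hin : inner ℂ (c a • P a g) (∑ i ∈ s, c i • P i g) = 0 := by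
        rw [inner_sum]
        refine Finset.sum_eq_zero fun i hi => ?_
        rw [inner_smul_left, inner_smul_right, sa, orth a i (by rintro rfl; exact ha hi)]
        simp
      have h1 := norm_add_sq_eq_norm_sq_add_norm_sq_of_inner_eq_zero _ _ hin
      rw [Finset.sum_insert ha, Finset.sum_insert ha, ← ih, sq, h1, norm_smul]
      ring
  have bd : ∀ (s : Finset ι) g,
      ‖∑ i ∈ s, (v i : ℂ) • P i g‖ ^ 2 ≤ K ^ 2 * ∑ i ∈ s, ‖P i g‖ ^ 2 := fun s g => by
    rw [pyth, Finset.mul_sum]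
    refine Finset.sum_le_sum fun i _ => ?_
    have : ‖(v i : ℂ)‖ ≤ K := by simpa using hv i
    gcongr
  have summ : ∀ g, Summable (fun i => (v i : ℂ) • P i g) := fun g => by
    rw [summable_iff_vanishing_norm]
    intro ε hε
    have h0 := (pars g).summable
    rw [summable_iff_vanishing_norm] at h0
    obtain ⟨s, hs⟩ := h0 (ε ^ 2 / (K ^ 2 + 1)) (by positivity)
    refine ⟨s, fun t ht => ?_⟩
    have h1 := hs t ht
    rw [Real.norm_of_nonneg (by positivity), lt_div_iff₀ (by positivity)] at h1
    have h2 := bd t g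
    have h3 : 0 ≤ ∑ i ∈ t, ‖P i g‖ ^ 2 := by positivity
    exact lt_of_pow_lt_pow_left₀ 2 hε.le (by nlinarith)
  have ex : ∃ T : E →L[ℂ] E, ∀ g, HasSum (fun i => (v i : ℂ) • P i g) (T g) := by
    refine ⟨LinearMap.mkContinuous
      { toFun := fun g => ∑' i, (v i : ℂ) • P i g
        map_add' := fun g h => by
          rw [← (summ g).tsum_add (summ h)]; simp
        map_smul' := fun c g => by
          rw [RingHom.id_apply, ← (summ g).tsum_const_smul c]
          congr 1; ext i; rw [map_smul, smul_comm] } |K| ?_, fun g => (summ g).hasSum⟩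
    intro g
    refine le_of_tendsto (summ g).hasSum.norm (Filter.Eventually.of_forall fun s => ?_)
    have h2 := bd s g
    have h3 := sum_le_hasSum s (fun _ _ => by positivity) (pars g)
    have h4 : ‖∑ i ∈ s, (v i : ℂ) • P i g‖ ^ 2 ≤ (|K| * ‖g‖) ^ 2 := by
      rw [mul_pow, sq_abs]; nlinarith [sq_nonneg K]
    exact le_of_sq_le_sq h4 (by positivity)
  rw [potential, dif_pos ex]
  exact ex.choose_spec f

/-- The generalized Anderson Hamiltonian `Δ ⊗ A + ∑_{i ∈ J} v i • P_i`, with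
`P_i = U_i P₀ U_i⁻¹`, for one realisation `v` of the coupling constants. -/
noncomputable def hamiltonian {d N : ℕ} (A : Matrix (Fin N) (Fin N) ℂ)
    (J : AddSubgroup (Fin d → ℤ)) (P₀ : Hil d N →L[ℂ] Hil d N) (v : J → ℝ) :
    Hil d N →L[ℂ] Hil d N :=
  kinetic d A + potential (fun i : J => translate P₀ (i : Fin d → ℤ)) v

/-- The eigenspace of a bounded operator for the real energy `E`. -/
noncomputable def eigSpace {d N : ℕ} (H : Hil d N →L[ℂ] Hil d N) (E : ℝ) :
    Submodule ℂ (Hil d N) :=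
  End.eigenspace (H : Hil d N →ₗ[ℂ] Hil d N) (E : ℂ)

/-- `f(H)` for a bounded self-adjoint operator `H` and a continuous function `f : ℝ → ℝ`. -/
noncomputable def funCalc {E : Type*} [NormedAddCommGroup E] [InnerProductSpace ℂ E]
    [CompleteSpace E] (f : ℝ → ℝ) (H : E →L[ℂ] E) : E →L[ℂ] E :=
  cfc f H

/-- The eigenfunction correlator
`sup { ‖(f(H) (δ_y ⊗ e_a))(x)‖ : f continuous, supp f ⊆ I, |f| ≤ 1, a }`. Here `f(H)` is given by
the continuous functional calculus of the self-adjoint operator `H`. -/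
noncomputable def correlator {d N : ℕ} (H : Hil d N →L[ℂ] Hil d N) (I : Set ℝ)
    (x y : Fin d → ℤ) : ℝ≥0∞ :=
  ⨆ (f : ℝ → ℝ) (_ : Continuous f) (_ : Function.support f ⊆ I) (_ : ∀ t, |f t| ≤ 1)
    (a : Fin N), ‖(funCalc f H (lp.single 2 y (EuclideanSpace.single a (1 : ℂ)))) x‖ₑ

/-- Strong dynamical localization in `I`: the expected eigenfunction correlator decays faster than
every power of the distance. -/
def DynamicallyLocalized {d N : ℕ} {Ω : Type*} [MeasurableSpace Ω] (μ : Measure Ω)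
    (H : Ω → Hil d N →L[ℂ] Hil d N) (I : Set ℝ) : Prop :=
  ∀ p : ℕ, ∃ C : ℝ, ∀ x y : Fin d → ℤ,
    ∫⁻ w, correlator (H w) I x y ∂μ ≤ ENNReal.ofReal (C / (1 + ‖x - y‖) ^ p)

/-- `ψ` decays faster than every power of `‖x‖`. -/
def RapidDecay {d N : ℕ} (ψ : Hil d N) : Prop :=
  ∀ p : ℕ, ∃ C : ℝ, ∀ x : Fin d → ℤ, ‖ψ x‖ ≤ C / (1 + ‖x‖) ^ p

/-- Spectral (Anderson) localization in `I`: almost surely `H` has pure point spectrum in `I`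
(every `f(H) ψ`, with `f` continuous and supported in `I`, is a limit of finite linear combinations
of eigenfunctions with eigenvalue in `I`) and the eigenfunctions with eigenvalue in `I` decay
rapidly. -/
def SpectrallyLocalized {d N : ℕ} {Ω : Type*} [MeasurableSpace Ω] (μ : Measure Ω)
    (H : Ω → Hil d N →L[ℂ] Hil d N) (I : Set ℝ) : Prop :=
  ∀ᵐ w ∂μ,
    (∀ f : ℝ → ℝ, Continuous f → Function.support f ⊆ I → ∀ ψ : Hil d N,
      funCalc f (H w) ψ ∈ (⨆ E ∈ I, eigSpace (H w) E).topologicalClosure) ∧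
    (∀ E ∈ I, ∀ ψ ∈ eigSpace (H w) E, RapidDecay ψ)

/-- The localization regime of a random operator: the energies having an open interval around them
in which localization holds, in the dynamical sense (the region of complete localization) or in
the spectral sense. -/
def localizationRegime {d N : ℕ} {Ω : Type*} [MeasurableSpace Ω] (μ : Measure Ω)
    (H : Ω → Hil d N →L[ℂ] Hil d N) : Set ℝ :=
  {E | ∃ a b : ℝ, a < E ∧ E < b ∧
    (DynamicallyLocalized μ H (Ioo a b) ∨ SpectrallyLocalized μ H (Ioo a b))}

end GenAnderson

/-!
The eigenspace of `H = K + ∑ j, v j • P j` at `E` is mapped by each `P i` into a space of dimension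
`m`. If its dimension exceeds `m`, then for every `i` it contains a nonzero `ψ` with `P i ψ = 0`;
and, being nonzero, it contains `φ` with `P i φ ≠ 0` for some `i`, as `∑ i, P i = 1`. It has to be
shown that, for each `i`, such a coexistence of `ψ` and `φ` (the set `badSet K P i` of couplings) has
probability zero.

Fix all couplings but the `i`-th. The vector `ψ` does not notice the value `t` of that coupling, so
`E` is an eigenvalue for all `t`, and hence belongs to a countable set that does not depend on `t`.
For fixed `E`, if `φ` and `φ'` are eigenvectors at `E` for two values `t ≠ t'`, then the symmetry of
`K` gives `(t - t') ⟪P i φ, P i φ'⟫ = 0`, so the nonzero vectors `P i φ` for different `t` are mutually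
orthogonal and only countably many `t` occur (`SolvesEigen.countable_coupling`). Hence the bad set has
countable sections along the `i`-th axis (`countable_badSet_section`). It is measurable inside a box
by weak-* compactness (`measurableSet_badSet_inter_box`), and the `i`-th coupling is independent of
the others with an atomless law, so Fubini's theorem applies (`ae_notMem_of_countable_sections`).

The argument bounds the multiplicity of every eigenvalue simultaneously, wherever it lies, and in
particular of those in the localization regime.
-/

namespace GenAnderson

/-! ### Eigenvectors relative to a resolution of the identity -/

section Abstract

variable {V ι : Type*} [NormedAddCommGroup V] [InnerProductSpace ℂ V]

/-- `ψ` solves the eigenvalue equation of `K + ∑ j, v j • P j` at energy `E`, written componentwise in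
the resolution of the identity `P`. In this form it makes sense for an arbitrary, possibly unbounded,
`v : ι → ℝ`, and the infinite series defining the potential does not occur. -/
def SolvesEigen (K : V →L[ℂ] V) (P : ι → V →L[ℂ] V) (v : ι → ℝ) (E : ℝ) (ψ : V) : Prop :=
  ∀ j, P j (K ψ) = ((E - v j : ℝ) : ℂ) • P j ψ

/-- A solution that `P i` does not see remains a solution when the `i`-th coupling is changed. -/
theorem SolvesEigen.update [DecidableEq ι] {K : V →L[ℂ] V} {P : ι → V →L[ℂ] V} {v : ι → ℝ}
    {E : ℝ} {ψ : V} {i : ι} (h : SolvesEigen K P v E ψ) (hi : P i ψ = 0) (t : ℝ) :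
    SolvesEigen K P (Function.update v i t) E ψ := by
  intro j
  rw [h j]
  rcases eq_or_ne j i with rfl | hj
  · simp [hi]
  · rw [Function.update_of_ne hj]

theorem countable_of_orthogonal [TopologicalSpace.SeparableSpace V] {α : Type*} {s : Set α}
    (f : α → V) (hne : ∀ a ∈ s, f a ≠ 0)
    (horth : ∀ a ∈ s, ∀ b ∈ s, a ≠ b → inner ℂ (f a) (f b) = 0) : s.Countable := by
  let g : α → V := fun a => ((‖f a‖⁻¹ : ℝ) : ℂ) • f a
  have hg : ∀ a ∈ s, ‖g a‖ = 1 := fun a ha => by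
    have := norm_ne_zero_iff.mpr (hne a ha)
    simp [g, norm_smul, this]
  refine PairwiseDisjoint.countable_of_isOpen (s := fun a => Metric.ball (g a) (1 / 2)) ?_
    (fun _ _ => Metric.isOpen_ball) (fun a _ => ⟨g a, Metric.mem_ball_self (by norm_num)⟩)
  intro a ha b hb hab
  refine Metric.ball_disjoint_ball ?_
  have h0 : inner ℂ (g a) (g b) = 0 := by
    simp [g, horth a ha b hb hab]
  have h1 := norm_sub_sq (𝕜 := ℂ) (g a) (g b)
  rw [h0, hg a ha, hg b hb] at h1
  rw [dist_eq_norm]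
  norm_num at h1
  nlinarith [norm_nonneg (g a - g b)]

variable [CompleteSpace V] {K : V →L[ℂ] V} {P : ι → V →L[ℂ] V}

theorem inner_starProjection {Q : V →L[ℂ] V} (hQ : IsStarProjection Q) (f g : V) :
    inner ℂ (Q f) g = inner ℂ f (Q g) := by
  have h : ContinuousLinearMap.adjoint Q = Q := hQ.isSelfAdjoint
  rw [← ContinuousLinearMap.adjoint_inner_right, h]

theorem starProjection_apply_apply {Q : V →L[ℂ] V} (hQ : IsStarProjection Q) (f : V) :
    Q (Q f) = Q f :=
  congrArg (fun T : V →L[ℂ] V => T f) hQ.isIdempotentElem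

theorem orthogonal_of_hasSum (hP : ∀ i, IsStarProjection (P i))
    (hsum : ∀ f, HasSum (fun i => P i f) f) {i j : ι} (hij : i ≠ j) (g : V) :
    P i (P j g) = 0 := by
  have h1 := (hsum (P j g)).mapL (innerSL ℂ (P j g))
  have h2 : ∀ k, innerSL ℂ (P j g) (P k (P j g)) = ((‖P k (P j g)‖ ^ 2 : ℝ) : ℂ) := fun k => by
    rw [innerSL_apply_apply, ← starProjection_apply_apply (hP k), ← inner_starProjection (hP k),
      inner_self_eq_norm_sq_to_K, starProjection_apply_apply (hP k)]
    norm_cast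
  simp only [h2, innerSL_apply_apply, inner_self_eq_norm_sq_to_K] at h1
  have h3 : HasSum (fun k => ‖P k (P j g)‖ ^ 2) (‖P j g‖ ^ 2) := by
    rw [← Complex.hasSum_ofReal]
    simpa using h1
  classical
  have h4 := sum_le_hasSum {i, j} (fun _ _ => by positivity) h3
  rw [Finset.sum_pair hij, starProjection_apply_apply (hP j)] at h4
  have : ‖P i (P j g)‖ ^ 2 ≤ 0 := by linarith
  simpa using le_antisymm this (by positivity)

theorem hasSum_inner_apply (hP : ∀ i, IsStarProjection (P i))
    (hsum : ∀ f, HasSum (fun i => P i f) f) (f g : V) :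
    HasSum (fun j => inner ℂ (P j f) g) (inner ℂ f g) := by
  simpa [inner_starProjection (hP _)] using (hsum g).mapL (innerSL ℂ f)

/-- Green's identity: the symmetric operator `K` drops out when two solutions, for possibly different
couplings and energies, are paired. -/
theorem SolvesEigen.hasSum_green (hK : ∀ f g, inner ℂ (K f) g = inner ℂ f (K g))
    (hP : ∀ i, IsStarProjection (P i)) (hsum : ∀ f, HasSum (fun i => P i f) f)
    {v w : ι → ℝ} {E F : ℝ} {ψ φ : V} (hψ : SolvesEigen K P v E ψ) (hφ : SolvesEigen K P w F φ) :
    HasSum (fun j => (((E - v j) - (F - w j) : ℝ) : ℂ) * inner ℂ (P j ψ) φ) 0 := by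
  have h1 := (hasSum_inner_apply hP hsum (K ψ) φ).sub (hasSum_inner_apply hP hsum ψ (K φ))
  rw [hK, sub_self] at h1
  have h2 : ∀ j, inner ℂ (P j (K ψ)) φ - inner ℂ (P j ψ) (K φ) =
      (((E - v j) - (F - w j) : ℝ) : ℂ) * inner ℂ (P j ψ) φ := fun j => by
    rw [hψ j, inner_starProjection (hP j) ψ (K φ), hφ j, inner_smul_left, inner_smul_right,
      Complex.conj_ofReal, inner_starProjection (hP j) ψ φ]
    push_cast
    ring
  simpa only [h2] using h1

theorem SolvesEigen.countable_eigenvalues [TopologicalSpace.SeparableSpace V]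
    (hK : ∀ f g, inner ℂ (K f) g = inner ℂ f (K g))
    (hP : ∀ i, IsStarProjection (P i)) (hsum : ∀ f, HasSum (fun i => P i f) f) (v : ι → ℝ) :
    {E : ℝ | ∃ ψ, ψ ≠ 0 ∧ SolvesEigen K P v E ψ}.Countable := by
  choose! f hf0 hf using fun (E : ℝ) (h : ∃ ψ, ψ ≠ 0 ∧ SolvesEigen K P v E ψ) => h
  refine countable_of_orthogonal f hf0 fun E hE F hF hEF => ?_
  have h1 := (hf E hE).hasSum_green hK hP hsum (hf F hF)
  have h2 := (hasSum_inner_apply hP hsum (f E) (f F)).mul_left ((E - F : ℝ) : ℂ)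
  have h3 : ((E - F : ℝ) : ℂ) ≠ 0 := by exact_mod_cast sub_ne_zero.mpr hEF
  simp only [sub_sub_sub_cancel_right] at h1
  exact (mul_eq_zero.mp (h2.unique h1)).resolve_left h3

/-- At a fixed energy `E`, the vectors `P i φ`, for solutions `φ` belonging to different values of the
`i`-th coupling, are mutually orthogonal by Green's identity; so only countably many values of that
coupling admit a solution with `P i φ ≠ 0`. This plays the role of spectral averaging. -/
theorem SolvesEigen.countable_coupling [TopologicalSpace.SeparableSpace V] [DecidableEq ι]
    (hK : ∀ f g, inner ℂ (K f) g = inner ℂ f (K g))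
    (hP : ∀ i, IsStarProjection (P i)) (hsum : ∀ f, HasSum (fun i => P i f) f) (v : ι → ℝ)
    (i : ι) (E : ℝ) :
    {t : ℝ | ∃ φ, P i φ ≠ 0 ∧ SolvesEigen K P (Function.update v i t) E φ}.Countable := by
  choose! f hf0 hf using
    fun (t : ℝ) (h : ∃ φ, P i φ ≠ 0 ∧ SolvesEigen K P (Function.update v i t) E φ) => h
  refine countable_of_orthogonal (fun t => P i (f t)) hf0 fun t ht s hs hts => ?_
  have h1 := (hf t ht).hasSum_green hK hP hsum (hf s hs)
  have h2 := h1.unique (hasSum_single i fun j hj => by simp [Function.update_of_ne hj])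
  simp only [Function.update_self] at h2
  have h3 : ((E - t - (E - s) : ℝ) : ℂ) ≠ 0 := by
    rw [Complex.ofReal_ne_zero]; intro h; apply hts; linarith
  simp only [zero_eq_mul, h3, false_or] at h2
  rw [← inner_starProjection (hP i), starProjection_apply_apply (hP i), h2]

/-- The couplings for which some energy has both a nonzero solution that `P i` annihilates and a
solution that it does not annihilate. -/
def badSet (K : V →L[ℂ] V) (P : ι → V →L[ℂ] V) (i : ι) : Set (ι → ℝ) :=
  {v | ∃ E ψ φ, SolvesEigen K P v E ψ ∧ ψ ≠ 0 ∧ P i ψ = 0 ∧ SolvesEigen K P v E φ ∧ P i φ ≠ 0}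

/-- An energy witnessing that `v` lies in `badSet K P i` is an eigenvalue for every value of the `i`-th
coupling, so along the `i`-th axis it ranges over one countable set. -/
theorem countable_badSet_section [TopologicalSpace.SeparableSpace V] [DecidableEq ι]
    (hK : ∀ f g, inner ℂ (K f) g = inner ℂ f (K g))
    (hP : ∀ i, IsStarProjection (P i)) (hsum : ∀ f, HasSum (fun i => P i f) f) (v : ι → ℝ)
    (i : ι) : {t : ℝ | Function.update v i t ∈ badSet K P i}.Countable := by
  refine ((SolvesEigen.countable_eigenvalues hK hP hsum v).biUnion fun E _ =>
    SolvesEigen.countable_coupling hK hP hsum v i E).mono ?_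
  rintro t ⟨E, ψ, φ, hψ, hψ0, hψi, hφ, hφi⟩
  refine mem_iUnion₂.mpr ⟨E, ⟨ψ, hψ0, ?_⟩, φ, hφi, hφ⟩
  simpa using hψ.update hψi (v i)

/-- The weak form of the equation, closed under weak-* limits of `⟪ψ, ·⟫` because all test vectors
are fixed. -/
theorem solvesEigen_iff_inner (hK : ∀ f g, inner ℂ (K f) g = inner ℂ f (K g))
    (hP : ∀ i, IsStarProjection (P i)) {v : ι → ℝ} {E : ℝ} {ψ : V} :
    SolvesEigen K P v E ψ ↔
      ∀ j f, inner ℂ ψ (K (P j f)) = ((E - v j : ℝ) : ℂ) * inner ℂ ψ (P j f) := by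
  refine forall_congr' fun j => ?_
  rw [ext_iff_inner_right ℂ]
  refine forall_congr' fun f => ?_
  rw [inner_smul_left, inner_starProjection (hP j), inner_starProjection (hP j), hK,
    Complex.conj_ofReal]

/-- Within a box the bad set is a countable union of projections of compact sets of quadruples
(coupling, energy, two functionals), by weak-* compactness of balls of the dual space. Measurability
matters: countable sections alone do not make a subset of a product null. -/
theorem measurableSet_badSet_inter_box [TopologicalSpace.SeparableSpace V] [Countable ι]
    (hK : ∀ f g, inner ℂ (K f) g = inner ℂ f (K g))
    (hP : ∀ i, IsStarProjection (P i)) (i : ι) (R : ℝ) :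
    MeasurableSet (badSet K P i ∩ univ.pi fun _ => Icc (-R) R) := by
  -- `n` bounds the energy and the norms of the functionals; the vectors `ξ` and `η` turn the open
  -- conditions `ψ ≠ 0` and `P i φ ≠ 0` into closed ones, after a normalization.
  let C : ℕ → V → V → Set ((ι → ℝ) × ℝ × WeakDual ℂ V × WeakDual ℂ V) := fun n ξ η =>
    ((univ.pi fun _ => Icc (-R) R) ×ˢ Icc (-n : ℝ) n ×ˢ
      (WeakDual.toStrongDual ⁻¹' Metric.closedBall 0 n) ×ˢ
      (WeakDual.toStrongDual ⁻¹' Metric.closedBall 0 n)) ∩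
    {q | (∀ j f, q.2.2.1 (K (P j f)) = ((q.2.1 - q.1 j : ℝ) : ℂ) * q.2.2.1 (P j f)) ∧
      (∀ j f, q.2.2.2 (K (P j f)) = ((q.2.1 - q.1 j : ℝ) : ℂ) * q.2.2.2 (P j f)) ∧
      (∀ f, q.2.2.1 (P i f) = 0) ∧ q.2.2.1 ξ = 1 ∧ q.2.2.2 (P i η) = 1}
  have hC : ∀ n ξ η, IsCompact (C n ξ η) := fun n ξ η => by
    refine ((isCompact_univ_pi fun _ => isCompact_Icc).prod (isCompact_Icc.prod
      ((WeakDual.isCompact_closedBall _ _).prod (WeakDual.isCompact_closedBall _ _)))).inter_right ?_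
    have e1 : ∀ f, Continuous fun q : (ι → ℝ) × ℝ × WeakDual ℂ V × WeakDual ℂ V => q.2.2.1 f :=
      fun f => (WeakDual.eval_continuous f).comp (by fun_prop)
    have e2 : ∀ f, Continuous fun q : (ι → ℝ) × ℝ × WeakDual ℂ V × WeakDual ℂ V => q.2.2.2 f :=
      fun f => (WeakDual.eval_continuous f).comp (by fun_prop)
    have e3 : ∀ j, Continuous fun q : (ι → ℝ) × ℝ × WeakDual ℂ V × WeakDual ℂ V =>
      ((q.2.1 - q.1 j : ℝ) : ℂ) := fun j => by fun_prop
    simp only [ofPred_and, ofPred_forall]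
    refine IsClosed.inter ?_ (IsClosed.inter ?_ (IsClosed.inter ?_ (IsClosed.inter ?_ ?_)))
    · exact isClosed_iInter fun j => isClosed_iInter fun f => isClosed_eq (e1 _) ((e3 j).mul (e1 _))
    · exact isClosed_iInter fun j => isClosed_iInter fun f => isClosed_eq (e2 _) ((e3 j).mul (e2 _))
    · exact isClosed_iInter fun f => isClosed_eq (e1 _) continuous_const
    · exact isClosed_eq (e1 _) continuous_const
    · exact isClosed_eq (e2 _) continuous_const
  have hEq : badSet K P i ∩ (univ.pi fun _ => Icc (-R) R) =
      ⋃ (n : ℕ) (a : ℕ) (b : ℕ),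
        Prod.fst '' C n (TopologicalSpace.denseSeq V a) (TopologicalSpace.denseSeq V b) := by
    ext v
    simp only [mem_iUnion, mem_image]
    constructor
    · rintro ⟨⟨E, ψ, φ, hψ, hψ0, hψi, hφ, hφi⟩, hv⟩
      obtain ⟨a, ha⟩ : ∃ a, inner ℂ ψ (TopologicalSpace.denseSeq V a) ≠ 0 := by
        by_contra! h
        exact hψ0 ((TopologicalSpace.denseRange_denseSeq V).eq_zero_of_inner_left ℂ h)
      obtain ⟨b, hb⟩ : ∃ b, inner ℂ φ (P i (TopologicalSpace.denseSeq V b)) ≠ 0 := by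
        by_contra! h
        simp only [← inner_starProjection (hP i)] at h
        exact hφi ((TopologicalSpace.denseRange_denseSeq V).eq_zero_of_inner_left ℂ h)
      let x : StrongDual ℂ V := (inner ℂ ψ (TopologicalSpace.denseSeq V a))⁻¹ • innerSL ℂ ψ
      let y : StrongDual ℂ V := (inner ℂ φ (P i (TopologicalSpace.denseSeq V b)))⁻¹ • innerSL ℂ φ
      obtain ⟨n, hn⟩ := exists_nat_ge (max |E| (max ‖x‖ ‖y‖))
      simp only [max_le_iff] at hn
      rw [solvesEigen_iff_inner hK hP] at hψ hφ
      refine ⟨n, a, b, (v, E, StrongDual.toWeakDual x, StrongDual.toWeakDual y),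
        ⟨⟨hv, abs_le.mp hn.1, ?_, ?_⟩, ?_, ?_, ?_, ?_, ?_⟩, rfl⟩
      · simpa using hn.2.1
      · simpa using hn.2.2
      · intro j f
        change _ * inner ℂ ψ _ = _ * (_ * inner ℂ ψ _)
        rw [hψ]; ring
      · intro j f
        change _ * inner ℂ φ _ = _ * (_ * inner ℂ φ _)
        rw [hφ]; ring
      · intro f
        change _ * inner ℂ ψ _ = 0
        rw [← inner_starProjection (hP i), hψi, inner_zero_left, mul_zero]
      · exact inv_mul_cancel₀ ha
      · exact inv_mul_cancel₀ hb
    · rintro ⟨n, a, b, ⟨v, E, x, y⟩, ⟨⟨hv, -⟩, h1, h2, h3, h4, h5⟩, rfl⟩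
      refine ⟨?_, hv⟩
      let ψ := (InnerProductSpace.toDual ℂ V).symm (WeakDual.toStrongDual x)
      let φ := (InnerProductSpace.toDual ℂ V).symm (WeakDual.toStrongDual y)
      have hψ : ∀ f, inner ℂ ψ f = x f := fun f => InnerProductSpace.toDual_symm_apply
      have hφ : ∀ f, inner ℂ φ f = y f := fun f => InnerProductSpace.toDual_symm_apply
      refine ⟨E, ψ, φ, ?_, ?_, ?_, ?_, ?_⟩
      · rw [solvesEigen_iff_inner hK hP]
        simpa only [hψ] using h1
      · intro h
        have := hψ (TopologicalSpace.denseSeq V a)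
        rw [h, inner_zero_left] at this
        exact zero_ne_one (this.trans h4)
      · refine ext_inner_right ℂ fun f => ?_
        rw [inner_starProjection (hP i), hψ, inner_zero_left]
        exact h3 f
      · rw [solvesEigen_iff_inner hK hP]
        simpa only [hφ] using h2
      · intro h
        have := hφ (P i (TopologicalSpace.denseSeq V b))
        rw [← inner_starProjection (hP i), h, inner_zero_left] at this
        exact zero_ne_one (this.trans h5)
  rw [hEq]
  exact MeasurableSet.iUnion fun n => MeasurableSet.iUnion fun a => MeasurableSet.iUnion fun b =>
    ((hC n _ _).image continuous_fst).measurableSet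

end Abstract

/-! ### Independent couplings with atomless laws -/

/-- Independent random variables almost surely avoid a measurable set whose sections along the `i`-th
axis are countable, if the `i`-th variable has no atoms. -/
theorem ae_notMem_of_countable_sections {ι Ω : Type*} [DecidableEq ι] [MeasurableSpace Ω]
    {μ : Measure Ω} [IsProbabilityMeasure μ] {ω : ι → Ω → ℝ} (hmeas : ∀ i, Measurable (ω i))
    (hindep : iIndepFun ω μ) (i : ι) [NullSingletonClass (μ.map (ω i))] {S : Set (ι → ℝ)}
    (hS : MeasurableSet S) (hcount : ∀ v, {t : ℝ | Function.update v i t ∈ S}.Countable) :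
    ∀ᵐ w ∂μ, (fun j => ω j w) ∉ S := by
  let r : Ω → ({j // j ≠ i} → ℝ) := fun w j => ω j w
  have hr : Measurable r := measurable_pi_lambda _ fun j => hmeas j
  have hind : IndepFun r (ω i) μ := by
    have h := indep_iSup_of_disjoint (fun j => (hmeas j).comap_le) hindep.iIndep
      (S := {j | j ≠ i}) (T := {i}) (by simp)
    refine indep_of_indep_of_le_left (indep_of_indep_of_le_right h ?_) ?_
    · simp
    · simp only [MeasurableSpace.pi, MeasurableSpace.comap_iSup, MeasurableSpace.comap_comp]
      exact iSup_le fun j => le_iSup₂_of_le (f := fun j (_ : j ∈ {j | j ≠ i}) =>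
        MeasurableSpace.comap (ω j) _) j.1 j.2 le_rfl
  -- `g` reassembles the family from its `i`-th member and the rest.
  let g : ({j // j ≠ i} → ℝ) × ℝ → ι → ℝ := fun p j => if h : j = i then p.2 else p.1 ⟨j, h⟩
  have hg : Measurable g := by
    refine measurable_pi_lambda _ fun j => ?_
    by_cases h : j = i
    · simpa [g, h] using measurable_snd
    · simp only [g, h, dite_false]
      exact (measurable_pi_apply (⟨j, h⟩ : {j // j ≠ i})).comp measurable_fst
  have hmap := hind.map_prod_eq_prod_map_map hr.aemeasurable (hmeas i).aemeasurable
  have hnull : (μ.map fun w => (r w, ω i w)) (g ⁻¹' S) = 0 := by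
    rw [hmap, Measure.measure_prod_null (hg hS)]
    refine Filter.Eventually.of_forall fun x => Set.Countable.measure_zero ?_ _
    refine (hcount (g (x, 0))).mono fun t ht => ?_
    have : Function.update (g (x, 0)) i t = g (x, t) := by
      ext j
      by_cases h : j = i
      · subst h; simp [g]
      · simp [g, h]
    simpa [this] using ht
  rw [Measure.map_apply (hr.prodMk (hmeas i)) (hg hS)] at hnull
  refine (measure_eq_zero_iff_ae_notMem.mp hnull).mono fun w hw hwS => hw ?_
  have : g (r w, ω i w) = fun j => ω j w := by
    ext j
    by_cases h : j = i
    · subst h; simp [g]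
    · simp [g, r, h]
  simpa [this] using hwS

/-! ### The generalized Anderson Hamiltonian -/

section Model

variable {d N : ℕ}

instance separableSpace_hil : TopologicalSpace.SeparableSpace (Hil d N) := by
  classical
  let S : Set (Hil d N) := ⋃ x : Fin d → ℤ, range (lp.single 2 x)
  have hS : TopologicalSpace.IsSeparable S :=
    .iUnion fun x => TopologicalSpace.isSeparable_range
      (lp.isometry_single x).continuous
  rw [← TopologicalSpace.isSeparable_univ_iff]
  refine (hS.span (R := ℂ)).closure.mono fun f _ => ?_
  refine mem_closure_of_tendsto (lp.hasSum_single (by norm_num) f)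
    (Filter.Eventually.of_forall fun s => Submodule.sum_mem _ fun x _ =>
      Submodule.subset_span (mem_iUnion.mpr ⟨x, _, rfl⟩))

theorem shift_apply (v : Fin d → ℤ) (f : Hil d N) (x : Fin d → ℤ) :
    shift d N v f x = f (x + v) := rfl

theorem shift_shift_neg (v : Fin d → ℤ) (f : Hil d N) : shift d N v (shift d N (-v) f) = f := by
  ext1; funext x; simp [shift_apply]

theorem inner_shift (v : Fin d → ℤ) (f g : Hil d N) :
    inner ℂ (shift d N v f) g = inner ℂ f (shift d N (-v) g) := by
  rw [lp.inner_eq_tsum, lp.inner_eq_tsum,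
    ← (Equiv.addRight v).tsum_eq fun x => inner ℂ (f x) (shift d N (-v) g x)]
  simp [shift_apply]

theorem isStarProjection_translate {P₀ : Hil d N →L[ℂ] Hil d N} (hP₀ : IsStarProjection P₀)
    (i : Fin d → ℤ) : IsStarProjection (translate P₀ i) := by
  constructor
  · refine ContinuousLinearMap.ext fun f => ?_
    change shift d N i (P₀ (shift d N (-i) (shift d N i (P₀ (shift d N (-i) f))))) = _
    have := shift_shift_neg (-i) (P₀ (shift d N (-i) f))
    rw [neg_neg] at this
    rw [this, starProjection_apply_apply hP₀]
    rfl
  · rw [ContinuousLinearMap.isSelfAdjoint_iff_isSymmetric]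
    intro f g
    change inner ℂ (shift d N i (P₀ (shift d N (-i) f))) g =
      inner ℂ f (shift d N i (P₀ (shift d N (-i) g)))
    rw [inner_shift, inner_starProjection hP₀, inner_shift, neg_neg]

theorem rank_translate_le (P₀ : Hil d N →L[ℂ] Hil d N) (i : Fin d → ℤ) :
    LinearMap.rank (translate P₀ i : Hil d N →ₗ[ℂ] Hil d N) ≤
      LinearMap.rank (P₀ : Hil d N →ₗ[ℂ] Hil d N) := by
  refine (LinearMap.rank_comp_le_right (P₀.comp (shift d N (-i)) : Hil d N →ₗ[ℂ] Hil d N)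
    (shift d N i : Hil d N →ₗ[ℂ] Hil d N)).trans ?_
  exact LinearMap.rank_comp_le_left (shift d N (-i) : Hil d N →ₗ[ℂ] Hil d N)
    (P₀ : Hil d N →ₗ[ℂ] Hil d N)

theorem inner_laplacian (f g : Hil d N) :
    inner ℂ (laplacian d N f) g = inner ℂ f (laplacian d N g) := by
  simp only [laplacian, _root_.sum_apply, _root_.add_apply, sum_inner,
    inner_sum, inner_add_left, inner_add_right, inner_shift, neg_neg]
  exact Finset.sum_congr rfl fun j _ => add_comm _ _

theorem inner_fibre {A : Matrix (Fin N) (Fin N) ℂ} (hA : A.IsHermitian) (f g : Hil d N) :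
    inner ℂ (fibre d A f) g = inner ℂ f (fibre d A g) := by
  have h : IsSelfAdjoint (Matrix.toEuclideanCLM (𝕜 := ℂ) A) :=
    IsSelfAdjoint.map hA _
  rw [lp.inner_eq_tsum, lp.inner_eq_tsum]
  refine tsum_congr fun x => ?_
  exact (ContinuousLinearMap.isSelfAdjoint_iff_isSymmetric.mp h) (f x) (g x)

theorem laplacian_fibre (A : Matrix (Fin N) (Fin N) ℂ) (f : Hil d N) :
    laplacian d N (fibre d A f) = fibre d A (laplacian d N f) := by
  simp only [laplacian, _root_.sum_apply, _root_.add_apply, map_sum,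
    map_add]
  rfl

theorem inner_kinetic {A : Matrix (Fin N) (Fin N) ℂ} (hA : A.IsHermitian) (f g : Hil d N) :
    inner ℂ (kinetic d A f) g = inner ℂ f (kinetic d A g) := by
  change inner ℂ (laplacian d N (fibre d A f)) g = inner ℂ f (laplacian d N (fibre d A g))
  rw [inner_laplacian, inner_fibre hA, laplacian_fibre]

theorem solvesEigen_of_mem_eigSpace {A : Matrix (Fin N) (Fin N) ℂ} {J : AddSubgroup (Fin d → ℤ)}
    {P₀ : Hil d N →L[ℂ] Hil d N} (hP₀ : IsStarProjection P₀)
    (hsum : ∀ f, HasSum (fun i : J => translate P₀ (i : Fin d → ℤ) f) f)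
    {v : J → ℝ} {R : ℝ} (hv : ∀ i, |v i| ≤ R) {E : ℝ} {ψ : Hil d N}
    (hψ : ψ ∈ eigSpace (hamiltonian A J P₀ v) E) :
    SolvesEigen (kinetic d A) (fun i : J => translate P₀ (i : Fin d → ℤ)) v E ψ := by
  intro j
  let P := fun i : J => translate P₀ (i : Fin d → ℤ)
  have hP : ∀ i, IsStarProjection (P i) := fun i => isStarProjection_translate hP₀ i
  have h1 := (potential_hasSum P hP hsum v hv ψ).mapL (P j)
  have h2 : P j (potential P v ψ) = (v j : ℂ) • P j ψ := by
    refine h1.unique ?_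
    convert hasSum_single j fun i hij => ?_ using 1
    · rw [map_smul, starProjection_apply_apply (hP j)]
    · rw [map_smul, orthogonal_of_hasSum hP hsum hij.symm, smul_zero]
  have h3 : kinetic d A ψ + potential P v ψ = (E : ℂ) • ψ := End.mem_eigenspace_iff.mp hψ
  have h4 := congrArg (P j) h3
  rw [map_add, h2, map_smul] at h4
  rw [Complex.ofReal_sub, sub_smul]
  exact eq_sub_of_add_eq h4

end Model

end GenAnderson

theorem theorem5p3 {d N m : ℕ} (hd : 1 ≤ d) (hm : 1 ≤ m)
    (A : Matrix (Fin N) (Fin N) ℂ) (hA : A.IsHermitian) (hAdet : IsUnit A.det)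
    (J : AddSubgroup (Fin d → ℤ))
    (P₀ : GenAnderson.Hil d N →L[ℂ] GenAnderson.Hil d N) (hP₀ : IsStarProjection P₀)
    (hrank : Module.finrank ℂ (LinearMap.range (P₀ : GenAnderson.Hil d N →ₗ[ℂ] GenAnderson.Hil d N)) = m)
    (hsum : ∀ f : GenAnderson.Hil d N,
      HasSum (fun i : J => GenAnderson.translate P₀ (i : Fin d → ℤ) f) f)
    {Ω : Type*} [MeasurableSpace Ω] (μ : Measure Ω) [IsProbabilityMeasure μ]
    (ω : J → Ω → ℝ) (hmeas : ∀ i, Measurable (ω i)) (hindep : iIndepFun ω μ)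
    (ρ : ℝ → ℝ) (hρmeas : Measurable ρ) (hρbdd : ∃ M : ℝ, ∀ t, ρ t ≤ M)
    (hρsupp : HasCompactSupport ρ)
    (hlaw : ∀ i, μ.map (ω i) = volume.withDensity (fun t => ENNReal.ofReal (ρ t))) :
    ∀ᵐ w ∂μ, ∀ E : ℝ,
      E ∈ GenAnderson.localizationRegime μ
          (fun w' => GenAnderson.hamiltonian A J P₀ (fun i => ω i w')) →
      Module.End.HasEigenvalue
          (GenAnderson.hamiltonian A J P₀ (fun i => ω i w) :
            GenAnderson.Hil d N →ₗ[ℂ] GenAnderson.Hil d N) (E : ℂ) →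
      Module.rank ℂ
          (GenAnderson.eigSpace (GenAnderson.hamiltonian A J P₀ (fun i => ω i w)) E) ≤ m := by
  open GenAnderson in
  classical
  let P := fun i : J => translate P₀ (i : Fin d → ℤ)
  have hP : ∀ i, IsStarProjection (P i) := fun i => isStarProjection_translate hP₀ i
  have hK := inner_kinetic (d := d) hA
  obtain ⟨R, hR⟩ := hρsupp.isBounded.subset_closedBall (0 : ℝ)
  have hbdd : ∀ᵐ w ∂μ, ∀ i, |ω i w| ≤ R := by
    refine ae_all_iff.mpr fun i => ?_
    have h : ∀ᵐ t ∂(μ.map (ω i)), |t| ≤ R := by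
      rw [hlaw i, ae_withDensity_iff (by fun_prop)]
      refine Filter.Eventually.of_forall fun t ht => ?_
      have h1 : t ∈ tsupport ρ := subset_tsupport ρ fun h0 => ht (by simp [h0])
      simpa using hR h1
    exact ae_of_ae_map (hmeas i).aemeasurable h
  have hbad : ∀ᵐ w ∂μ, ∀ i, (fun j => ω j w) ∉
      badSet (kinetic d A) P i ∩ univ.pi fun _ => Icc (-R) R := by
    refine ae_all_iff.mpr fun i => ?_
    have : NullSingletonClass (μ.map (ω i)) := by
      rw [hlaw i]
      exact ⟨fun t => withDensity_absolutelyContinuous _ _ (measure_singleton t)⟩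
    exact ae_notMem_of_countable_sections hmeas hindep i
      (measurableSet_badSet_inter_box hK hP i R)
      fun v => (countable_badSet_section hK hP hsum v i).mono fun t ht => ht.1
  have hfin : LinearMap.rank (P₀ : Hil d N →ₗ[ℂ] Hil d N) = m := by
    have : Module.Finite ℂ (LinearMap.range (P₀ : Hil d N →ₗ[ℂ] Hil d N)) :=
      Module.finite_of_finrank_pos (by omega)
    rw [LinearMap.rank, ← Module.finrank_eq_rank, hrank]
  filter_upwards [hbdd, hbad] with w hw hwbad E _ hE
  have hsol := fun ψ hψ =>
    solvesEigen_of_mem_eigSpace (A := A) (E := E) (ψ := ψ) hP₀ hsum hw hψ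
  obtain ⟨φ, hφ, hφ0⟩ := hE.exists_hasEigenvector
  obtain ⟨i, hi⟩ : ∃ i, P i φ ≠ 0 := by
    by_contra! h
    exact hφ0 ((hsum φ).unique (by simpa [P] using (hasSum_zero.congr_fun h)))
  -- `P i` has rank at most `m`; off the bad set it is injective on the whole eigenspace.
  let T := (P i : Hil d N →ₗ[ℂ] Hil d N) ∘ₗ (eigSpace (hamiltonian A J P₀ fun i => ω i w) E).subtype
  have hT : Function.Injective T := by
    refine (injective_iff_map_eq_zero T).mpr fun ψ hψ => ?_
    by_contra hψ0
    exact hwbad i ⟨⟨E, ψ, φ, hsol ψ ψ.2, by simpa using hψ0, hψ, hsol φ hφ, hi⟩,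
      fun j _ => abs_le.mp (hw j)⟩
  calc Module.rank ℂ (eigSpace (hamiltonian A J P₀ fun i => ω i w) E)
      = LinearMap.rank T := (rank_range_of_injective T hT).symm
    _ ≤ LinearMap.rank (P i : Hil d N →ₗ[ℂ] Hil d N) := LinearMap.rank_comp_le_left _ _
    _ ≤ LinearMap.rank (P₀ : Hil d N →ₗ[ℂ] Hil d N) := rank_translate_le P₀ i
    _ = m := hfin
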